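/- A label multiplicity distribution is a probability distribution $\psi$ on $\{0,1,2,\dots\}$ whose first and second moments are positive and finite. The random temporal graph $\Gamma_{[n]}(\psi)$ has vertex set $[n]$; independently for each of the $\binom n2$ pairs $e$ of vertices, a number $l_e\sim\psi$ is drawn, and the set $\lambda(e)$ of time labels of the edge $e$ consists of $l_e$ independent uniform samples from $(0,1]$. For a finite graph $H$, a strict partial order $\prec$ on its edge set, and $\delta\in\mathbb R$, a temporal graph $(V,E,\lambda)$ contains $(H,\prec)$ as a $\delta$-temporal motif if there are a subgraph $I$ of $(V,E)$, a choice of one label $\lambda'(e)\in\lambda(e)$ for every edge $e$ of $I$, and a graph isomorphism $\Phi:H\to I$ such that $e\prec f$ implies $\lambda'(\Phi(e))<\lambda'(\Phi(f))$ for all edges $e,f$ of $H$, and $\lambda'(e)-\lambda'(f)<\delta$ for all edges $e,f$ of $I$. "With high probability" means with probability tending to $1$ as $n\to\infty$; $\delta=\omega(g)$ means that $\delta$ is eventually nonnegative and $g=o(\delta)$. Theorem. Let $\psi$ be a label multiplicity distribution. Let $i\ge 3$, let $C_i$ be the cycle on $i$ vertices, let $P_i$ be any strict partial order on its edges, and let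 $\delta:\mathbb N\to\mathbb R$. Then a random temporal graph drawn from $\Gamma_{[n]}(\psi)$ - contains $(C_i,P_i)$ as a $\delta(n)$-temporal motif with high probability if $\delta(n)=\omega(n^{-i/(i-1)})$; - does not contain $(C_i,P_i)$ as a $\delta(n)$-temporal motif with high probability if $\delta(n)=o(n^{-i/(i-1)})$. Moreover, cycles of different lengths have distinct thresholds: call an eventually positive function $\tau:\mathbb N\to\mathbb R$ a threshold for $(H,\prec)$ if $\Gamma_{[n]}(\psi)$ contains $(H,\prec)$ as a $\delta(n)$-temporal motif with high probability whenever $\delta=\omega(\tau)$ and, with high probability, does not whenever $\delta=o(\tau)$. Then for all $3\le i<j$ one has $n^{-i/(i-1)}=o(n^{-j/(j-1)})$, and for all strict partial orders $P_i$, $P_j$ on the edges of $C_i$, $C_j$ no function is a threshold for both $(C_i,P_i)$ and $(C_j,P_j)$. -/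

import Mathlib

open Filter Topology MeasureTheory Asymptotics

/-- A temporal graph on the vertex set `V`: a static graph together with a finite set of positive
real time labels on every edge. -/
structure TemporalGraph (V : Type*) where
  graph : SimpleGraph V
  label : graph.edgeSet → Finset ℝ
  label_pos : ∀ e, ∀ t ∈ label e, 0 < t

namespace TemporalGraph

/-- A simple temporal subgraph of `G`: a subgraph `(V', E')` of the underlying static graph in which
every edge `e` carries exactly one time label `time e`, chosen among the labels of `e` in `G`.
The edges of `sub` are read as edges of `sub.coe`, the subgraph as a graph on its own vertex set. -/
structure SimpleSubgraph {V : Type*} (G : TemporalGraph V) where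
  sub : G.graph.Subgraph
  time : sub.coe.edgeSet → ℝ
  time_mem : ∀ e, time e ∈ G.label (sub.hom.mapEdgeSet e)

/-- `G` contains `(H, prec)` as a `δ`-temporal motif, where `prec` is a (strict partial order)
relation on the edges of `H`: some simple temporal subgraph of `G` is isomorphic to `H` by a map
that realizes `prec` by the time labels, and all its labels differ by less than `δ`. -/
def ContainsMotif {V W : Type*} (G : TemporalGraph V) (H : SimpleGraph W)
    (prec : H.edgeSet → H.edgeSet → Prop) (δ : ℝ) : Prop :=
  ∃ (I : G.SimpleSubgraph) (Φ : H ≃g I.sub.coe),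
    (∀ e f : H.edgeSet, prec e f → I.time (Φ.mapEdgeSet e) < I.time (Φ.mapEdgeSet f)) ∧
    ∀ e f : I.sub.coe.edgeSet, I.time e - I.time f < δ

end TemporalGraph

/-- A label multiplicity distribution: a distribution on `ℕ` whose first and second moments are
positive and finite. -/
structure IsLabelMultiplicity (ψ : PMF ℕ) : Prop where
  mean_pos : 0 < ∑' k : ℕ, (k : ENNReal) * ψ k
  mean_lt_top : ∑' k : ℕ, (k : ENNReal) * ψ k < ⊤
  second_pos : 0 < ∑' k : ℕ, (k : ENNReal) ^ 2 * ψ k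
  second_lt_top : ∑' k : ℕ, (k : ENNReal) ^ 2 * ψ k < ⊤

/-- The uniform distribution on `(0, 1]`: Lebesgue measure on that interval. -/
noncomputable def uniformIoc : Measure (Set.Ioc (0 : ℝ) 1) :=
  Measure.comap (fun t => (t : ℝ)) volume

instance isProbabilityMeasure_uniformIoc : IsProbabilityMeasure uniformIoc := by
  constructor
  rw [uniformIoc, comap_subtype_coe_apply measurableSet_Ioc, Set.image_univ, Subtype.range_coe,
    Real.volume_Ioc]
  simp

/-- Sample space for the continuous random temporal graph on `V`: for each of the unordered pairs
of distinct vertices, a number of labels and a sequence of potential labels in `(0, 1]`. -/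
abbrev LabelSample (V : Type*) : Type _ :=
  (⊤ : SimpleGraph V).edgeSet → ℕ × (ℕ → Set.Ioc (0 : ℝ) 1)

/-- The probability measure underlying the continuous random temporal graph: independently over the
edges, the number of labels has distribution `ψ`, and the potential labels are independent of it
and of each other, and uniform on `(0, 1]`. -/
noncomputable def labelMeasure (V : Type*) [Fintype V] [DecidableEq V] (ψ : PMF ℕ) :
    Measure (LabelSample V) :=
  Measure.pi fun _ => ψ.toMeasure.prod (Measure.infinitePi fun _ : ℕ => uniformIoc)

/-- The random temporal graph on `V`: the labels of the edge `e` are the first `l_e` of its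
potential labels. Its law under `labelMeasure V ψ` is the continuous model with vertex set `V` and
label multiplicity distribution `ψ`. -/
noncomputable def randomTemporalGraph {V : Type*} (ω : LabelSample V) : TemporalGraph V where
  graph := ⊤
  label e := (Finset.range (ω e).1).image fun k => ((ω e).2 k : ℝ)
  label_pos e t ht := by
    obtain ⟨k, -, rfl⟩ := Finset.mem_image.1 ht
    exact ((ω e).2 k).2.1

/-- With high probability (as `n → ∞`), the random temporal graph on `n` vertices contains
`(H, prec)` as a `δ n`-temporal motif. -/
def ContainsMotifWhp {W : Type*} (ψ : PMF ℕ) (H : SimpleGraph W)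
    (prec : H.edgeSet → H.edgeSet → Prop) (δ : ℕ → ℝ) : Prop :=
  Tendsto (fun n : ℕ => labelMeasure (Fin n) ψ
    {ω | (randomTemporalGraph ω).ContainsMotif H prec (δ n)}) atTop (𝓝 1)

/-- With high probability (as `n → ∞`), the random temporal graph on `n` vertices does not contain
`(H, prec)` as a `δ n`-temporal motif. -/
def AvoidsMotifWhp {W : Type*} (ψ : PMF ℕ) (H : SimpleGraph W)
    (prec : H.edgeSet → H.edgeSet → Prop) (δ : ℕ → ℝ) : Prop :=
  Tendsto (fun n : ℕ => labelMeasure (Fin n) ψ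
    {ω | ¬ (randomTemporalGraph ω).ContainsMotif H prec (δ n)}) atTop (𝓝 1)

/-- `f = ω(g)` for sequences: `f` is eventually nonnegative and `g = o(f)`. -/
def IsLittleOmega (f g : ℕ → ℝ) : Prop :=
  (∀ᶠ n in atTop, 0 ≤ f n) ∧ g =o[atTop] f

/-- The eventually positive function `τ` is an existence threshold for the motif `(H, prec)`:
windows `δ = ω(τ)` give the motif and windows `δ = o(τ)` avoid it, with high probability. -/
def IsMotifThreshold {W : Type*} (ψ : PMF ℕ) (H : SimpleGraph W)
    (prec : H.edgeSet → H.edgeSet → Prop) (τ : ℕ → ℝ) : Prop :=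
  (∀ᶠ n in atTop, 0 < τ n) ∧
  (∀ δ : ℕ → ℝ, IsLittleOmega δ τ → ContainsMotifWhp ψ H prec δ) ∧
  ∀ δ : ℕ → ℝ, δ =o[atTop] τ → AvoidsMotifWhp ψ H prec δ

/-- The function `n ^ (-i / (i - 1))`. -/
noncomputable def cycleThreshold (i : ℕ) : ℕ → ℝ :=
  fun n => (n : ℝ) ^ (-((i : ℝ) / ((i : ℝ) - 1)))

/-! Let `τ = cycleThreshold i`, so `n ^ i * τ ^ (i - 1) = 1`. There are about `n ^ i` copies of the
cycle and about `1 / δ` windows of length of order `δ`, and all `i` edges of a copy have a label in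
a given window with probability of order `δ ^ i`. The expected number of pairs (copy, window) is
thus of order `n ^ i * δ ^ (i - 1) = (δ / τ) ^ (i - 1)`, whatever the partial order.

Below `τ` a union bound suffices (`labelMeasure_containsMotif_le`).

Above `τ` the second moment method is applied to a thinned family. Vertices are split into residue
classes mod `i`, each with `m = n / i` usable vertices, and only copies with one vertex in each
class, in the prescribed place, are counted. `(0, 1]` is cut into `W = ⌈1 / δ⌉₊` windows of `i`
slots each, and every edge must have its first label in the slot given by its rank in a
linearization of the order. A shared edge has the same rank in both copies, so events in different
windows that share an edge exclude each other. Within one window, copies agreeing on a proper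
nonempty vertex set of size `t` share at most `t - 1` edges, which is where the cycle enters
(`isCycleSparse_cycleGraph`). Hence the variance over the squared mean is at most a constant times
`1 / m + W ^ (i - 1) / m ^ i` (`labelMeasure_real_iInter_slotEvent_compl_le`), which tends to 0.

A common threshold for two lengths is refuted by testing windows strictly between the two cycle
thresholds (`not_isMotifThreshold_both`). -/

namespace TemporalGraph

/-! ### Motifs as copies with chosen labels -/

/-- Containing a motif amounts to having a copy of the pattern together with a suitable choice of
one label for every edge of the pattern. -/
theorem containsMotif_iff_exists_copy {V W : Type*} (G : TemporalGraph V) (H : SimpleGraph W)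
    (prec : H.edgeSet → H.edgeSet → Prop) (δ : ℝ) :
    G.ContainsMotif H prec δ ↔ ∃ (f : H.Copy G.graph) (t : H.edgeSet → ℝ),
      (∀ e, t e ∈ G.label (f.mapEdgeSet e)) ∧ (∀ e e', prec e e' → t e < t e') ∧
      ∀ e e', t e - t e' < δ := by
  constructor
  · rintro ⟨I, Φ, hprec, hδ⟩
    refine ⟨⟨I.sub.hom.comp Φ.toHom, I.sub.hom_injective.comp Φ.injective⟩,
      fun e => I.time (Φ.mapEdgeSet e), fun e => ?_, hprec, fun e e' => hδ _ _⟩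
    convert I.time_mem (Φ.mapEdgeSet e) using 2
    obtain ⟨e, he⟩ := e
    apply Subtype.ext
    induction e with | _ a b => rfl
  · rintro ⟨f, t, ht, hprec, hδ⟩
    refine ⟨⟨f.toSubgraph, fun e => t (f.isoToSubgraph.mapEdgeSet.symm e), fun e => ?_⟩,
      f.isoToSubgraph, fun e e' h => by
        simpa only [Equiv.symm_apply_apply] using hprec e e' h, fun e e' => hδ _ _⟩
    obtain ⟨e, rfl⟩ := f.isoToSubgraph.mapEdgeSet.surjective e
    rw [Equiv.symm_apply_apply]
    convert ht e using 2
    obtain ⟨e, he⟩ := e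
    apply Subtype.ext
    induction e with | _ a b => rfl

end TemporalGraph

theorem mem_label_randomTemporalGraph {V : Type*} (ω : LabelSample V)
    (e : (⊤ : SimpleGraph V).edgeSet) (t : ℝ) :
    t ∈ (randomTemporalGraph ω).label e ↔ ∃ k < (ω e).1, ((ω e).2 k : ℝ) = t := by
  change t ∈ (Finset.range (ω e).1).image (fun k => ((ω e).2 k : ℝ)) ↔ _
  simp

theorem containsMotif_randomTemporalGraph_iff {V W : Type*} (ω : LabelSample V)
    (H : SimpleGraph W) (prec : H.edgeSet → H.edgeSet → Prop) (δ : ℝ) :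
    (randomTemporalGraph ω).ContainsMotif H prec δ ↔
      ∃ (f : H.Copy (⊤ : SimpleGraph V)) (k : H.edgeSet → ℕ),
        (∀ e, k e < (ω (f.mapEdgeSet e)).1) ∧
        (∀ e e', prec e e' →
          ((ω (f.mapEdgeSet e)).2 (k e) : ℝ) < (ω (f.mapEdgeSet e')).2 (k e')) ∧
        ∀ e e', ((ω (f.mapEdgeSet e)).2 (k e) : ℝ) - (ω (f.mapEdgeSet e')).2 (k e') < δ := by
  rw [TemporalGraph.containsMotif_iff_exists_copy]
  refine exists_congr fun f => ⟨?_, ?_⟩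
  · rintro ⟨t, ht, h⟩
    choose k hk hkt using fun e =>
      (mem_label_randomTemporalGraph ω (f.mapEdgeSet e) (t e)).1 (ht e)
    obtain rfl := funext hkt
    exact ⟨k, hk, h⟩
  · rintro ⟨k, hk, h⟩
    exact ⟨_, fun e => (mem_label_randomTemporalGraph ω _ _).2 ⟨k e, hk e, rfl⟩, h⟩

/-! ### Law of a single edge -/

/-- The law of the number of labels and of the potential labels of a single edge. -/
noncomputable abbrev edgeLaw (ψ : PMF ℕ) : Measure (ℕ × (ℕ → Set.Ioc (0 : ℝ) 1)) :=
  ψ.toMeasure.prod (Measure.infinitePi fun _ : ℕ => uniformIoc)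

instance isProbabilityMeasure_labelMeasure (V : Type*) [Fintype V] [DecidableEq V] (ψ : PMF ℕ) :
    IsProbabilityMeasure (labelMeasure V ψ) := by
  unfold labelMeasure
  infer_instance

theorem labelMeasure_forall_mem {V : Type*} [Fintype V] [DecidableEq V] (ψ : PMF ℕ)
    (S : Finset (⊤ : SimpleGraph V).edgeSet)
    (B : (⊤ : SimpleGraph V).edgeSet → Set (ℕ × (ℕ → Set.Ioc (0 : ℝ) 1))) :
    labelMeasure V ψ {ω | ∀ e ∈ S, ω e ∈ B e} = ∏ e ∈ S, edgeLaw ψ (B e) :=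
  Measure.pi_pi_finset (fun _ => edgeLaw ψ) B S

/-- Only an inequality, because the windows of the first moment bound may stick out beyond 1. -/
theorem uniformIoc_preimage_le (a b : ℝ) :
    uniformIoc {u | (u : ℝ) ∈ Set.Ioc a b} ≤ ENNReal.ofReal (b - a) := by
  rw [uniformIoc, comap_subtype_coe_apply measurableSet_Ioc, ← Real.volume_Ioc]
  refine measure_mono ?_
  rintro _ ⟨u, hu, rfl⟩
  exact hu

theorem uniformIoc_preimage {a b : ℝ} (ha : 0 ≤ a) (hb : b ≤ 1) :
    uniformIoc {u | (u : ℝ) ∈ Set.Ioc a b} = ENNReal.ofReal (b - a) := by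
  rw [uniformIoc, comap_subtype_coe_apply measurableSet_Ioc, ← Real.volume_Ioc]
  congr 1
  ext t
  constructor
  · rintro ⟨u, hu, rfl⟩
    exact hu
  · intro ht
    exact ⟨⟨t, ha.trans_lt ht.1, ht.2.trans hb⟩, ht, rfl⟩

theorem infinitePi_uniformIoc_eval (k : ℕ) {s : Set (Set.Ioc (0 : ℝ) 1)} (hs : MeasurableSet s) :
    Measure.infinitePi (fun _ : ℕ => uniformIoc) {u | u k ∈ s} = uniformIoc s :=
  (measurePreserving_eval_infinitePi (fun _ : ℕ => uniformIoc) k).measure_preimage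
    hs.nullMeasurableSet

theorem measurableSet_unit_mem_Ioc (a b : ℝ) :
    MeasurableSet {u : Set.Ioc (0 : ℝ) 1 | (u : ℝ) ∈ Set.Ioc a b} :=
  measurable_subtype_coe measurableSet_Ioc

/-- The event that an edge has a label in `(a, b]`. -/
def hasLabelIn (a b : ℝ) : Set (ℕ × (ℕ → Set.Ioc (0 : ℝ) 1)) :=
  {p | ∃ k < p.1, (p.2 k : ℝ) ∈ Set.Ioc a b}

theorem measurableSet_hasLabelIn (a b : ℝ) : MeasurableSet (hasLabelIn a b) := by
  have : hasLabelIn a b = ⋃ k : ℕ, {p | k < p.1} ∩ {p | (p.2 k : ℝ) ∈ Set.Ioc a b} := by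
    ext p
    simp [hasLabelIn]
  rw [this]
  refine MeasurableSet.iUnion fun k =>
    (measurable_fst (MeasurableSet.of_discrete (s := Set.Ioi k))).inter ?_
  exact (measurable_subtype_coe.comp ((measurable_pi_apply k).comp measurable_snd)) measurableSet_Ioc

/-- Given `l` labels, a union bound yields `l * (b - a)`; averaging over `l` produces the mean of
`ψ`. -/
theorem edgeLaw_hasLabelIn_le (ψ : PMF ℕ) (a b : ℝ) :
    edgeLaw ψ (hasLabelIn a b) ≤ (∑' k : ℕ, (k : ENNReal) * ψ k) * ENNReal.ofReal (b - a) := by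
  rw [Measure.prod_apply (measurableSet_hasLabelIn a b), lintegral_countable',
    ← ENNReal.tsum_mul_right]
  refine ENNReal.tsum_le_tsum fun l => ?_
  rw [PMF.toMeasure_apply_singleton _ _ (measurableSet_singleton l), mul_right_comm]
  gcongr
  calc _ ≤ Measure.infinitePi (fun _ : ℕ => uniformIoc)
        (⋃ k ∈ Finset.range l, {u | u k ∈ {v : Set.Ioc (0 : ℝ) 1 | (v : ℝ) ∈ Set.Ioc a b}}) := by
        refine measure_mono ?_
        rintro u ⟨k, hk, hu⟩
        simp only [Set.mem_iUnion]
        exact ⟨k, Finset.mem_range.2 hk, hu⟩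
    _ ≤ ∑ k ∈ Finset.range l, ENNReal.ofReal (b - a) := by
        refine (measure_biUnion_finset_le _ _).trans (Finset.sum_le_sum fun k _ => ?_)
        rw [infinitePi_uniformIoc_eval k (measurableSet_unit_mem_Ioc a b)]
        exact uniformIoc_preimage_le a b
    _ = _ := by simp

/-- The event that an edge has a label and that its first label lies in `(a, b]`. -/
def firstLabelIn (a b : ℝ) : Set (ℕ × (ℕ → Set.Ioc (0 : ℝ) 1)) :=
  Set.Ioi 0 ×ˢ {u | (u 0 : ℝ) ∈ Set.Ioc a b}

theorem measurableSet_firstLabelIn (a b : ℝ) : MeasurableSet (firstLabelIn a b) :=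
  MeasurableSet.of_discrete.prod
    ((measurable_subtype_coe.comp (measurable_pi_apply 0)) measurableSet_Ioc)

theorem edgeLaw_firstLabelIn (ψ : PMF ℕ) {a b : ℝ} (ha : 0 ≤ a) (hb : b ≤ 1) :
    edgeLaw ψ (firstLabelIn a b) = ψ.toMeasure (Set.Ioi 0) * ENNReal.ofReal (b - a) := by
  rw [firstLabelIn, Measure.prod_prod, ← uniformIoc_preimage ha hb,
    ← infinitePi_uniformIoc_eval 0 (measurableSet_unit_mem_Ioc a b)]
  rfl

theorem IsLabelMultiplicity.toMeasure_Ioi_pos {ψ : PMF ℕ} (hψ : IsLabelMultiplicity ψ) :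
    0 < ψ.toMeasure (Set.Ioi 0) := by
  obtain ⟨k, hk⟩ : ∃ k : ℕ, (k : ENNReal) * ψ k ≠ 0 := by
    by_contra! h
    simpa [h] using hψ.mean_pos
  have hk0 : k ≠ 0 := by rintro rfl; simp at hk
  refine (pos_iff_ne_zero.2 (right_ne_zero_of_mul hk)).trans_le ?_
  rw [← PMF.toMeasure_apply_singleton ψ k (measurableSet_singleton k)]
  exact measure_mono (by simpa using Nat.pos_of_ne_zero hk0)

/-! ### First moment method below the threshold -/

theorem card_edgeSet_cycleGraph {i : ℕ} (hi : 3 ≤ i) :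
    Fintype.card (SimpleGraph.cycleGraph i).edgeSet = i := by
  obtain ⟨m, rfl⟩ := Nat.exists_eq_add_of_le' hi
  have h := (SimpleGraph.cycleGraph (m + 3)).sum_degrees_eq_twice_card_edges
  simp only [SimpleGraph.cycleGraph_degree_three_le, Finset.sum_const, Finset.card_univ,
    Fintype.card_fin, smul_eq_mul] at h
  rw [← SimpleGraph.edgeFinset_card]
  omega

theorem cycleThreshold_pos (i : ℕ) {n : ℕ} (hn : 0 < n) : 0 < cycleThreshold i n :=
  Real.rpow_pos_of_pos (by exact_mod_cast hn) _

/-- This identity is how the exponent `i / (i - 1)` enters both moment bounds. -/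
theorem cycleThreshold_pow {i : ℕ} (hi : 2 ≤ i) (n : ℕ) :
    cycleThreshold i n ^ (i - 1) = ((n : ℝ) ^ i)⁻¹ := by
  have h : (i : ℝ) - 1 ≠ 0 := by
    have : (2 : ℝ) ≤ i := by exact_mod_cast hi
    linarith
  rw [cycleThreshold, ← Real.rpow_natCast, ← Real.rpow_mul (Nat.cast_nonneg n),
    Nat.cast_sub (by omega), Nat.cast_one, neg_mul, div_mul_cancel₀ _ h,
    Real.rpow_neg (Nat.cast_nonneg n), Real.rpow_natCast]

theorem card_copy_top_le (i n : ℕ) (H : SimpleGraph (Fin i)) :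
    Fintype.card (H.Copy (⊤ : SimpleGraph (Fin n))) ≤ n ^ i := by
  refine (Fintype.card_le_of_injective (fun (f : H.Copy (⊤ : SimpleGraph (Fin n))) a => f a)
    DFunLike.coe_injective).trans ?_
  simp

/-- Labels in `(0, 1]` that differ by less than `δ` lie in a common window of length `2 * δ` that
starts at a multiple of `δ`. -/
theorem exists_window {ι : Type*} [Finite ι] [Nonempty ι] {t : ι → ℝ} {δ : ℝ} (hδ : 0 < δ)
    (h0 : ∀ e, 0 < t e) (h1 : ∀ e, t e ≤ 1) (h : ∀ e e', t e - t e' < δ) :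
    ∃ s < ⌈1 / δ⌉₊, ∀ e, t e ∈ Set.Ioc (s * δ) ((s + 2) * δ) := by
  obtain ⟨e₀, he₀⟩ := Finite.exists_min t
  have hpos : 0 < ⌈t e₀ / δ⌉₊ := Nat.ceil_pos.2 (div_pos (h0 e₀) hδ)
  have hle : ⌈t e₀ / δ⌉₊ ≤ ⌈1 / δ⌉₊ := Nat.ceil_mono (by gcongr; exact h1 e₀)
  -- `s` is the ceiling minus one, so the smallest label satisfies `s * δ < t e₀ ≤ (s + 1) * δ`,
  -- strict on the left as the half-open window requires.
  obtain ⟨s, hs⟩ := Nat.exists_eq_succ_of_ne_zero hpos.ne'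
  have h2 : t e₀ / δ ≤ (s + 1 : ℕ) := by
    rw [← Nat.succ_eq_add_one, ← hs]
    exact Nat.le_ceil _
  have h3 : (s : ℝ) < t e₀ / δ := Nat.lt_ceil.1 (by omega)
  rw [div_le_iff₀ hδ] at h2
  rw [lt_div_iff₀ hδ] at h3
  push_cast at h2
  refine ⟨s, by omega, fun e => ⟨h3.trans_le (he₀ e), ?_⟩⟩
  linarith [h e e₀]

/-- Union bound over copies and windows. The order is dropped, and edges of one copy are
independent. -/
theorem labelMeasure_containsMotif_le (ψ : PMF ℕ) {i : ℕ} (H : SimpleGraph (Fin i))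
    [Fintype H.edgeSet] [Nonempty H.edgeSet] (prec : H.edgeSet → H.edgeSet → Prop) {δ : ℝ}
    (hδ : 0 < δ) (n : ℕ) :
    labelMeasure (Fin n) ψ {ω | (randomTemporalGraph ω).ContainsMotif H prec δ} ≤
      n ^ i * (⌈1 / δ⌉₊ * ((∑' k : ℕ, (k : ENNReal) * ψ k) * ENNReal.ofReal (2 * δ)) ^
        Fintype.card H.edgeSet) := by
  classical
  set q := (∑' k : ℕ, (k : ENNReal) * ψ k) * ENNReal.ofReal (2 * δ)
  let S (f : H.Copy (⊤ : SimpleGraph (Fin n))) : Finset (⊤ : SimpleGraph (Fin n)).edgeSet :=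
    Finset.univ.map f.mapEdgeSet
  calc _ ≤ labelMeasure (Fin n) ψ (⋃ f ∈ (Finset.univ : Finset (H.Copy (⊤ : SimpleGraph (Fin n)))),
        ⋃ s ∈ Finset.range ⌈1 / δ⌉₊, {ω | ∀ e ∈ S f, ω e ∈ hasLabelIn (s * δ) ((s + 2) * δ)}) := by
        refine measure_mono fun ω hω => ?_
        obtain ⟨f, k, hk, -, hkδ⟩ := (containsMotif_randomTemporalGraph_iff ω H prec δ).1 hω
        obtain ⟨s, hs, hst⟩ := exists_window hδ (fun e => ((ω _).2 (k e)).2.1)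
          (fun e => ((ω _).2 (k e)).2.2) hkδ
        simp only [Set.mem_iUnion]
        refine ⟨f, Finset.mem_univ _, s, Finset.mem_range.2 hs, fun e he => ?_⟩
        obtain ⟨e, -, rfl⟩ := Finset.mem_map.1 he
        exact ⟨k e, hk e, hst e⟩
    _ ≤ ∑ f : H.Copy (⊤ : SimpleGraph (Fin n)), ∑ s ∈ Finset.range ⌈1 / δ⌉₊,
        q ^ Fintype.card H.edgeSet := by
        refine (measure_biUnion_finset_le _ _).trans (Finset.sum_le_sum fun f _ => ?_)
        refine (measure_biUnion_finset_le _ _).trans (Finset.sum_le_sum fun s _ => ?_)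
        rw [labelMeasure_forall_mem]
        refine (Finset.prod_le_pow_card _ _ q fun e _ => ?_).trans_eq (by simp [S])
        refine (edgeLaw_hasLabelIn_le ψ _ _).trans_eq ?_
        rw [show ((s : ℝ) + 2) * δ - s * δ = 2 * δ by ring]
    _ ≤ _ := by
        simp only [Finset.sum_const, Finset.card_univ, nsmul_eq_mul, Finset.card_range]
        gcongr
        exact_mod_cast card_copy_top_le i n H

theorem tendsto_labelMeasure_containsMotif {ψ : PMF ℕ} (hψ : IsLabelMultiplicity ψ) {i : ℕ}
    (hi : 3 ≤ i)
    (P : (SimpleGraph.cycleGraph i).edgeSet → (SimpleGraph.cycleGraph i).edgeSet → Prop)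
    {δ : ℕ → ℝ} (hδ : δ =o[atTop] cycleThreshold i) :
    Tendsto (fun n : ℕ => labelMeasure (Fin n) ψ
      {ω | (randomTemporalGraph ω).ContainsMotif (SimpleGraph.cycleGraph i) P (δ n)})
      atTop (𝓝 0) := by
  set L : ℝ := (∑' k : ℕ, (k : ENNReal) * ψ k).toReal
  have hL : ENNReal.ofReal L = ∑' k : ℕ, (k : ENNReal) * ψ k :=
    ENNReal.ofReal_toReal hψ.mean_lt_top.ne
  have hL0 : 0 ≤ L := ENNReal.toReal_nonneg
  have hcard := card_edgeSet_cycleGraph hi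
  have : Nonempty (SimpleGraph.cycleGraph i).edgeSet := Fintype.card_pos_iff.1 (by omega)
  have hratio : Tendsto (fun n => |δ n| / cycleThreshold i n) atTop (𝓝 0) := by
    have := hδ.abs_left.tendsto_div_nhds_zero
    exact this
  have hlim : Tendsto (fun n => ENNReal.ofReal
      (2 * (2 * L) ^ i * (|δ n| / cycleThreshold i n) ^ (i - 1))) atTop (𝓝 0) := by
    rw [← ENNReal.ofReal_zero]
    refine ENNReal.tendsto_ofReal ?_
    simpa [show i - 1 ≠ 0 by omega] using (hratio.pow (i - 1)).const_mul (2 * (2 * L) ^ i)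
  refine tendsto_of_tendsto_of_tendsto_of_le_of_le' tendsto_const_nhds hlim
    (Eventually.of_forall fun n => zero_le) ?_
  filter_upwards [eventually_gt_atTop 0, hratio.eventually_lt_const one_pos] with n hn hlt
  -- For `δ n ≤ 0` the window condition already fails for an edge compared with itself.
  rcases le_or_gt (δ n) 0 with h0 | h0
  · rw [show {ω : LabelSample (Fin n) | (randomTemporalGraph ω).ContainsMotif
        (SimpleGraph.cycleGraph i) P (δ n)} = ∅ from Set.eq_empty_of_forall_notMem fun ω hω => ?_]
    · simp
    · obtain ⟨f, k, -, -, hk⟩ := (containsMotif_randomTemporalGraph_iff ω _ P _).1 hω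
      have e := Classical.arbitrary (SimpleGraph.cycleGraph i).edgeSet
      linarith [hk e e]
  have hτ := cycleThreshold_pos i hn
  have hτ1 : cycleThreshold i n ≤ 1 := by
    refine Real.rpow_le_one_of_one_le_of_nonpos (by exact_mod_cast hn) ?_
    have : (3 : ℝ) ≤ i := by exact_mod_cast hi
    exact neg_nonpos.2 (div_nonneg (by linarith) (by linarith))
  rw [abs_of_pos h0] at hlt ⊢
  have hδ1 : δ n ≤ 1 := by
    rw [div_lt_one hτ] at hlt
    linarith
  refine (labelMeasure_containsMotif_le ψ _ P h0 n).trans ?_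
  rw [hcard, ← hL, ← ENNReal.ofReal_mul hL0, ← ENNReal.ofReal_pow (by positivity),
    ← ENNReal.ofReal_natCast n, ← ENNReal.ofReal_natCast ⌈1 / δ n⌉₊,
    ← ENNReal.ofReal_pow (by positivity), ← ENNReal.ofReal_mul (by positivity),
    ← ENNReal.ofReal_mul (by positivity)]
  refine ENNReal.ofReal_le_ofReal ?_
  -- Rounding up costs at most a factor 2 because `δ n ≤ 1`.
  have hceil : (⌈1 / δ n⌉₊ : ℝ) ≤ 2 / δ n := by
    have h1 : (1 : ℝ) ≤ 1 / δ n := by rwa [le_div_iff₀ h0, one_mul]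
    have := (Nat.ceil_lt_add_one (by positivity : 0 ≤ 1 / δ n)).le
    calc _ ≤ 1 / δ n + 1 / δ n := by linarith
      _ = _ := by ring
  calc _ ≤ (n : ℝ) ^ i * (2 / δ n * (L * (2 * δ n)) ^ i) := by gcongr
    _ = _ := by
      rw [div_pow, cycleThreshold_pow (by omega), div_inv_eq_mul]
      obtain ⟨j, rfl⟩ := Nat.exists_eq_add_of_le' (show 1 ≤ i by omega)
      simp only [Nat.add_sub_cancel]
      field_simp
      ring

/-! ### Second moment inequality -/

/-- The second moment method for a finite family of events. -/
theorem measureReal_iInter_compl_mul_sq_le {Ω ι : Type*} [MeasurableSpace Ω] (μ : Measure Ω)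
    [IsProbabilityMeasure μ] [Fintype ι] {A : ι → Set Ω} (hA : ∀ j, MeasurableSet (A j)) :
    μ.real (⋂ j, (A j)ᶜ) * (∑ j, μ.real (A j)) ^ 2 ≤
      ∑ j, ∑ l, μ.real (A j ∩ A l) - (∑ j, μ.real (A j)) ^ 2 := by
  set M := ∑ j, μ.real (A j)
  let f : Ω → ℝ := fun ω => ∑ j, (A j).indicator 1 ω
  have hint (s : Set Ω) (hs : MeasurableSet s) : Integrable (s.indicator (1 : Ω → ℝ)) μ :=
    (integrable_const 1).indicator hs
  have hf : Integrable f μ := integrable_finsetSum _ fun j _ => hint _ (hA j)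
  have hfM : ∫ ω, f ω ∂μ = M := by
    rw [integral_finsetSum _ fun j _ => hint _ (hA j)]
    exact Finset.sum_congr rfl fun j _ => integral_indicator_one (hA j)
  have hmul : (fun ω => f ω * f ω) = fun ω => ∑ j, ∑ l, (A j ∩ A l).indicator 1 ω := by
    funext ω
    simp only [f, Finset.sum_mul_sum, Set.inter_indicator_one, Pi.mul_apply]
  have hff : Integrable (fun ω => f ω * f ω) μ := by
    rw [hmul]
    exact integrable_finsetSum _ fun j _ => integrable_finsetSum _ fun l _ =>
      hint _ ((hA j).inter (hA l))
  have hffM : ∫ ω, f ω * f ω ∂μ = ∑ j, ∑ l, μ.real (A j ∩ A l) := by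
    rw [hmul, integral_finsetSum _ fun j _ => integrable_finsetSum _ fun l _ =>
      hint _ ((hA j).inter (hA l))]
    refine Finset.sum_congr rfl fun j _ => ?_
    rw [integral_finsetSum _ fun l _ => hint _ ((hA j).inter (hA l))]
    exact Finset.sum_congr rfl fun l _ => integral_indicator_one ((hA j).inter (hA l))
  have hlin : Integrable (fun ω => 2 * M * f ω) μ := hf.const_mul _
  have hsub : Integrable (fun ω => f ω * f ω - 2 * M * f ω) μ := hff.sub hlin
  have hS : MeasurableSet (⋂ j, (A j)ᶜ) := MeasurableSet.iInter fun j => (hA j).compl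
  calc μ.real (⋂ j, (A j)ᶜ) * M ^ 2 = ∫ ω, (⋂ j, (A j)ᶜ).indicator 1 ω * M ^ 2 ∂μ := by
        rw [integral_mul_const, integral_indicator_one hS]
    -- The integrand on the right is `(f - M) ^ 2`: it equals `M ^ 2` where no event occurs and is
    -- nonnegative elsewhere.
    _ ≤ ∫ ω, (f ω * f ω - 2 * M * f ω + M ^ 2) ∂μ := by
        refine integral_mono ((hint _ hS).mul_const _)
          (hsub.add (integrable_const _)) fun ω => ?_
        by_cases hω : ω ∈ ⋂ j, (A j)ᶜ
        · have h0 : f ω = 0 := Finset.sum_eq_zero fun j _ =>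
            Set.indicator_of_notMem (Set.mem_iInter.1 hω j) _
          simp [hω, h0]
        · simp only [hω, not_false_eq_true, Set.indicator_of_notMem, zero_mul]
          nlinarith [sq_nonneg (f ω - M)]
    _ = _ := by
        rw [integral_add hsub (integrable_const _), integral_sub hff hlin, integral_const_mul, hfM, hffM]
        simp only [integral_const, probReal_univ, one_smul]
        ring

/-! ### Copies transversal to the residue classes, and their overlaps -/

/-- The class of a vertex of `Fin n` modulo `i`. -/
def vertexClass (i : ℕ) [NeZero i] {n : ℕ} (v : Fin n) : Fin i := Fin.ofNat i v

/-- The copy of `H` in a complete graph whose vertex `a` is the `x a`-th vertex of class `a`. -/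
def classCopy {i m n : ℕ} (H : SimpleGraph (Fin i)) (h : i * m ≤ n) (x : Fin i → Fin m) :
    H.Copy (⊤ : SimpleGraph (Fin n)) where
  toHom :=
    { toFun := fun a => ⟨i * x a + a, by
        have := Nat.mul_le_mul_left i (x a).2
        rw [Nat.succ_eq_add_one, mul_add, mul_one] at this
        have := a.2
        omega⟩
      map_rel' := fun {a b} hab => by
        rw [SimpleGraph.top_adj]
        intro hEq
        refine hab.ne (Fin.ext ?_)
        simpa [Nat.mul_add_mod, Nat.mod_eq_of_lt a.2, Nat.mod_eq_of_lt b.2] using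
          congrArg (fun v : Fin n => (v : ℕ) % i) hEq }
  injective' a b hEq := by
    refine Fin.ext ?_
    simpa [Nat.mul_add_mod, Nat.mod_eq_of_lt a.2, Nat.mod_eq_of_lt b.2] using
      congrArg (fun v : Fin n => (v : ℕ) % i) hEq

theorem vertexClass_classCopy {i m n : ℕ} [NeZero i] (H : SimpleGraph (Fin i)) (h : i * m ≤ n)
    (x : Fin i → Fin m) (a : Fin i) : vertexClass i (classCopy H h x a) = a := by
  refine Fin.ext ?_
  change (i * (x a : ℕ) + a) % i = a
  rw [Nat.mul_add_mod, Nat.mod_eq_of_lt a.2]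

theorem classCopy_apply_eq_iff {i m n : ℕ} (H : SimpleGraph (Fin i)) (h : i * m ≤ n)
    (x y : Fin i → Fin m) (a : Fin i) : classCopy H h x a = classCopy H h y a ↔ x a = y a := by
  have hi : 0 < i := a.pos
  refine ⟨fun hEq => Fin.ext ?_, fun hEq => Fin.ext ?_⟩
  · have : i * (x a : ℕ) + a = i * y a + a := congrArg Fin.val hEq
    exact Nat.eq_of_mul_eq_mul_left hi (by omega)
  · change i * (x a : ℕ) + a = i * y a + a
    rw [hEq]

/-- Reduction mod `i` recovers the pattern edge from its image, whichever copy it came from. Hence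
ranks are well defined on edges of the complete graph, and a shared edge plays the same role in both
copies. -/
theorem map_vertexClass_mapEdgeSet {i m n : ℕ} [NeZero i] (H : SimpleGraph (Fin i))
    (h : i * m ≤ n) (x : Fin i → Fin m) (e : H.edgeSet) :
    Sym2.map (vertexClass i) ((classCopy H h x).mapEdgeSet e : Sym2 (Fin n)) = e := by
  obtain ⟨e, he⟩ := e
  induction e with | _ a b =>
  change s(vertexClass i (classCopy H h x a), vertexClass i (classCopy H h x b)) = s(a, b)
  rw [vertexClass_classCopy, vertexClass_classCopy]

/-- The edges of the copy `classCopy H h x`. -/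
def classEdges {i m n : ℕ} (H : SimpleGraph (Fin i)) [Fintype H.edgeSet] (h : i * m ≤ n)
    (x : Fin i → Fin m) : Finset (⊤ : SimpleGraph (Fin n)).edgeSet :=
  Finset.univ.map (classCopy H h x).mapEdgeSet

theorem card_classEdges {i m n : ℕ} (H : SimpleGraph (Fin i)) [Fintype H.edgeSet]
    (h : i * m ≤ n) (x : Fin i → Fin m) :
    (classEdges H h x).card = Fintype.card H.edgeSet := by
  simp [classEdges]

/-- Every nonempty vertex set spans at most as many edges as it has vertices, and fewer if it is
not the set of all vertices. -/
def IsCycleSparse {i : ℕ} (H : SimpleGraph (Fin i)) [Fintype H.edgeSet] : Prop :=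
  ∀ T : Finset (Fin i), T.Nonempty →
    (Finset.univ.filter fun e : H.edgeSet => ∀ a ∈ e.1, a ∈ T).card +
      (if T = Finset.univ then 0 else 1) ≤ T.card

/-- A shared edge comes from one pattern edge, and comparing classes shows that the copies agree at
both of its ends. -/
theorem card_classEdges_inter_le {i m n : ℕ} [NeZero i] (H : SimpleGraph (Fin i))
    [Fintype H.edgeSet] (h : i * m ≤ n) (x y : Fin i → Fin m) :
    (classEdges H h x ∩ classEdges H h y).card ≤
      (Finset.univ.filter fun e : H.edgeSet =>
        ∀ a ∈ e.1, a ∈ Finset.univ.filter fun a => x a = y a).card := by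
  rw [← Finset.card_map (classCopy H h x).mapEdgeSet]
  refine Finset.card_le_card fun e' he' => ?_
  obtain ⟨hx, hy⟩ := Finset.mem_inter.1 he'
  obtain ⟨e, -, rfl⟩ := Finset.mem_map.1 hx
  obtain ⟨e₁, -, he₁⟩ := Finset.mem_map.1 hy
  obtain rfl : e₁ = e := by
    rw [Subtype.ext_iff, ← map_vertexClass_mapEdgeSet H h y e₁, he₁,
      map_vertexClass_mapEdgeSet H h x e]
  refine Finset.mem_map_of_mem _ (Finset.mem_filter.2 ⟨Finset.mem_univ _, fun a ha => ?_⟩)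
  rw [Finset.mem_filter_univ, ← classCopy_apply_eq_iff H h]
  have hmem : classCopy H h x a ∈ ((classCopy H h y).mapEdgeSet e₁ : Sym2 (Fin n)) := by
    rw [he₁]
    exact Sym2.mem_map.2 ⟨a, ha, rfl⟩
  obtain ⟨b, hb, hba⟩ := Sym2.mem_map.1 hmem
  have hba' : classCopy H h y b = classCopy H h x a := hba
  obtain rfl : b = a := by
    rw [← vertexClass_classCopy H h y b, hba', vertexClass_classCopy]
  exact hba'.symm

/-- The number of functions that agree with a given one on `T`. -/
theorem card_filter_forall_eq {i m : ℕ} (T : Finset (Fin i)) (x : Fin i → Fin m) :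
    (Finset.univ.filter fun y : Fin i → Fin m => ∀ a ∈ T, y a = x a).card = m ^ (i - T.card) := by
  have : (Finset.univ.filter fun y : Fin i → Fin m => ∀ a ∈ T, y a = x a) =
      Fintype.piFinset fun a => if a ∈ T then {x a} else Finset.univ := by
    ext y
    simp only [Finset.mem_filter_univ, Fintype.mem_piFinset]
    refine forall_congr' fun a => ?_
    split_ifs with ha <;> simp [ha]
  rw [this, Fintype.card_piFinset, ← Finset.prod_mul_prod_compl T,
    Finset.prod_eq_one fun a ha => by simp [ha], one_mul,
    Finset.prod_congr rfl (g := fun _ => m) fun a ha => by simp [Finset.mem_compl.1 ha]]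
  simp [Finset.card_compl]

theorem IsCycleSparse.card_inter_le {i m n : ℕ} [NeZero i] {H : SimpleGraph (Fin i)}
    [Fintype H.edgeSet] (hH : IsCycleSparse H) (h : i * m ≤ n) {x y : Fin i → Fin m}
    {T : Finset (Fin i)} (hT : T = Finset.univ.filter fun a => x a = y a) (hne : T.Nonempty) :
    (classEdges H h x ∩ classEdges H h y).card + (if T = Finset.univ then 0 else 1) ≤ T.card := by
  subst hT
  exact (Nat.add_le_add_right (card_classEdges_inter_le H h x y) _).trans (hH _ hne)

theorem agree_nonempty_of_card_inter_ne_zero {i m n : ℕ} [NeZero i] {H : SimpleGraph (Fin i)}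
    [Fintype H.edgeSet] (h : i * m ≤ n) {x y : Fin i → Fin m}
    (hs : (classEdges H h x ∩ classEdges H h y).card ≠ 0) :
    (Finset.univ.filter fun a => x a = y a).Nonempty := by
  obtain ⟨⟨e, he'⟩, he⟩ := Finset.card_pos.1
    ((Nat.pos_of_ne_zero hs).trans_le (card_classEdges_inter_le H h x y))
  induction e with | _ a b => exact ⟨a, (Finset.mem_filter.1 he).2 a (Sym2.mem_mk_left a b)⟩

/-- After raising to the power `i - 1`, the hypothesis reduces this to `i * (t - 2) ≤ (t - 1) * (i -
1)`, which follows from `t ≤ i`. It says that partial overlaps weigh no more than the count of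
vertex choices they lose. -/
theorem pow_sub_two_le_pow_sub_one {i m W t : ℕ} (h : W ^ (i - 1) ≤ m ^ i) (hm : 0 < m)
    (h2 : 2 ≤ t) (hti : t ≤ i) : W ^ (t - 2) ≤ m ^ (t - 1) := by
  obtain ⟨s, rfl⟩ := Nat.exists_eq_add_of_le' h2
  obtain ⟨j, rfl⟩ := Nat.exists_eq_add_of_le' (show 1 ≤ i by omega)
  simp only [Nat.add_sub_cancel, show s + 2 - 1 = s + 1 by omega] at *
  refine le_of_pow_le_pow_left₀ (n := j) (by omega) (Nat.zero_le _) ?_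
  calc (W ^ s) ^ j = (W ^ j) ^ s := by rw [← pow_mul, ← pow_mul, mul_comm]
    _ ≤ (m ^ (j + 1)) ^ s := Nat.pow_le_pow_left h s
    _ = m ^ ((j + 1) * s) := (pow_mul _ _ _).symm
    _ ≤ m ^ ((s + 1) * j) := Nat.pow_le_pow_right hm (by nlinarith)
    _ = _ := pow_mul _ _ _

/-- The total weight of the copies that share edges with a given copy. -/
theorem sum_pow_card_inter_le {i m n W : ℕ} [NeZero i] {H : SimpleGraph (Fin i)}
    [Fintype H.edgeSet] (hH : IsCycleSparse H) (h : i * m ≤ n) (hm : 0 < m) (hW : 0 < W)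
    (hWm : W ^ (i - 1) ≤ m ^ i) (x : Fin i → Fin m) :
    ∑ y : Fin i → Fin m, (if (classEdges H h x ∩ classEdges H h y).card = 0 then 0
      else W ^ (classEdges H h x ∩ classEdges H h y).card) ≤
      W * (2 ^ i * m ^ (i - 1) + W ^ (i - 1)) := by
  have hi : 0 < i := NeZero.pos i
  -- `W * φ T` bounds the weight of a copy whose agreement set with `x` is exactly `T`. In the sum
  -- below a copy is also charged to every subset of that set, which only enlarges the bound.
  let φ : Finset (Fin i) → ℕ := fun T => if T = ∅ then 0 else
    if T = Finset.univ then W ^ (i - 1) else m ^ (T.card - 1)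
  calc _ ≤ ∑ y : Fin i → Fin m, ∑ T : Finset (Fin i),
        if ∀ a ∈ T, y a = x a then W * φ T else 0 := by
        refine Finset.sum_le_sum fun y _ => ?_
        split_ifs with hs
        · exact Nat.zero_le _
        set s := (classEdges H h x ∩ classEdges H h y).card with hsdef
        set T := Finset.univ.filter fun a => x a = y a with hT
        have hne : T.Nonempty := agree_nonempty_of_card_inter_ne_zero h hs
        have hsT := hH.card_inter_le h hT hne
        rw [← hsdef] at hsT
        have hTi : T.card ≤ i := by simpa using T.card_le_univ
        refine le_trans ?_ (Finset.single_le_sum (fun _ _ => Nat.zero_le _) (Finset.mem_univ T))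
        rw [if_pos fun a ha => (Finset.mem_filter.1 ha).2.symm]
        simp only [φ, if_neg hne.ne_empty]
        split_ifs at hsT ⊢ with hTu
        · rw [← pow_succ']
          exact Nat.pow_le_pow_right hW (by omega)
        -- Here `1 ≤ s ≤ T.card - 1`, so `T.card ≥ 2` and the natural subtraction is exact.
        · calc W ^ s ≤ W ^ (T.card - 2 + 1) := Nat.pow_le_pow_right hW (by omega)
            _ = W * W ^ (T.card - 2) := pow_succ' _ _
            _ ≤ _ := Nat.mul_le_mul_left _ (pow_sub_two_le_pow_sub_one hWm hm (by omega) hTi)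
    _ = ∑ T : Finset (Fin i), m ^ (i - T.card) * (W * φ T) := by
        rw [Finset.sum_comm]
        refine Finset.sum_congr rfl fun T _ => ?_
        rw [← Finset.sum_filter, Finset.sum_const, card_filter_forall_eq, smul_eq_mul]
    -- For proper nonempty `T` the powers of `m` combine to `m ^ (i - 1)` regardless of `T.card`;
    -- the `2 ^ i` subsets give the constant.
    _ ≤ ∑ T : Finset (Fin i), (W * m ^ (i - 1) + if T = Finset.univ then W * W ^ (i - 1) else 0) := by
        refine Finset.sum_le_sum fun T _ => ?_
        have hTi : T.card ≤ i := by simpa using T.card_le_univ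
        by_cases h0 : T = ∅
        · simp [φ, h0]
        have hpos : 0 < T.card := Finset.card_pos.2 (Finset.nonempty_of_ne_empty h0)
        simp only [φ, if_neg h0]
        split_ifs with hTu
        · subst hTu
          simp
        · rw [mul_left_comm, ← pow_add, show i - T.card + (T.card - 1) = i - 1 by omega, add_zero]
    _ = _ := by
        rw [Finset.sum_add_distrib, Finset.sum_ite_eq' _ _]
        simp
        ring

/-! ### Second moment of the slot events -/

/-- The event that the edges of a copy all fall into their slots of the window `w`. -/
def slotEvent {i m n W : ℕ} (H : SimpleGraph (Fin i)) [Fintype H.edgeSet] (h : i * m ≤ n)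
    (D : Fin W → (⊤ : SimpleGraph (Fin n)).edgeSet → Set (ℕ × (ℕ → Set.Ioc (0 : ℝ) 1)))
    (p : (Fin i → Fin m) × Fin W) : Set (LabelSample (Fin n)) :=
  {ω | ∀ e ∈ classEdges H h p.1, ω e ∈ D p.2 e}

theorem labelMeasure_real_forall_mem {V : Type*} [Fintype V] [DecidableEq V] (ψ : PMF ℕ)
    (S : Finset (⊤ : SimpleGraph V).edgeSet)
    {B : (⊤ : SimpleGraph V).edgeSet → Set (ℕ × (ℕ → Set.Ioc (0 : ℝ) 1))} {q : ℝ}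
    (hB : ∀ e, (edgeLaw ψ).real (B e) = q) :
    (labelMeasure V ψ).real {ω | ∀ e ∈ S, ω e ∈ B e} = q ^ S.card := by
  rw [measureReal_def, labelMeasure_forall_mem, ENNReal.toReal_prod]
  exact Finset.prod_eq_pow_card fun e _ => hB e

theorem measurableSet_forall_mem {V : Type*} [Finite V]
    (S : Finset (⊤ : SimpleGraph V).edgeSet)
    {B : (⊤ : SimpleGraph V).edgeSet → Set (ℕ × (ℕ → Set.Ioc (0 : ℝ) 1))}
    (hB : ∀ e, MeasurableSet (B e)) :
    MeasurableSet {ω : LabelSample V | ∀ e ∈ S, ω e ∈ B e} := by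
  have : {ω : LabelSample V | ∀ e ∈ S, ω e ∈ B e} = ⋂ e ∈ S, {ω | ω e ∈ B e} := by
    ext ω
    simp
  rw [this]
  exact Finset.measurableSet_biInter _ fun e _ => measurable_pi_apply e (hB e)

section

variable {i m n W : ℕ} {H : SimpleGraph (Fin i)} [Fintype H.edgeSet]
  {D : Fin W → (⊤ : SimpleGraph (Fin n)).edgeSet → Set (ℕ × (ℕ → Set.Ioc (0 : ℝ) 1))}

theorem labelMeasure_real_slotEvent (ψ : PMF ℕ) (h : i * m ≤ n) {q : ℝ}
    (hq : ∀ w e, (edgeLaw ψ).real (D w e) = q) (p : (Fin i → Fin m) × Fin W) :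
    (labelMeasure (Fin n) ψ).real (slotEvent H h D p) = q ^ Fintype.card H.edgeSet := by
  rw [slotEvent, labelMeasure_real_forall_mem ψ _ (hq _), card_classEdges]

/-- The summand 1 is the independent contribution, which later cancels against the squared mean.
With `s` shared edges in the same window the exponent drops by `s`, costing `(W / c) ^ s`, where
`c⁻¹ ^ s` is bounded by `c⁻¹ ^ i`; with a shared edge in different windows the intersection is
empty. -/
theorem labelMeasure_real_slotEvent_inter_le [NeZero i] (ψ : PMF ℕ) (hH : IsCycleSparse H)
    (h : i * m ≤ n) {c : ℝ} (hc0 : 0 < c) (hc1 : c ≤ 1) (hW : 0 < W)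
    (hq : ∀ w e, (edgeLaw ψ).real (D w e) = c / W)
    (hdisj : ∀ w v e, w ≠ v → Disjoint (D w e) (D v e)) (p p' : (Fin i → Fin m) × Fin W) :
    (labelMeasure (Fin n) ψ).real (slotEvent H h D p ∩ slotEvent H h D p') ≤
      (c / W) ^ (2 * Fintype.card H.edgeSet) * (1 + if p.2 = p'.2 then (c ^ i)⁻¹ *
        ((if (classEdges H h p.1 ∩ classEdges H h p'.1).card = 0 then 0
          else W ^ (classEdges H h p.1 ∩ classEdges H h p'.1).card : ℕ) : ℝ) else 0) := by
  obtain ⟨x, w⟩ := p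
  obtain ⟨y, v⟩ := p'
  set S := classEdges H h x with hS
  set S' := classEdges H h y with hS'
  set K := Fintype.card H.edgeSet
  have hcard : (S ∪ S').card + (S ∩ S').card = 2 * K := by
    rw [Finset.card_union_add_card_inter, card_classEdges, card_classEdges, two_mul]
  have hW' : (0 : ℝ) < W := by exact_mod_cast hW
  have hcW : 0 < c / W := by positivity
  simp only
  by_cases h0 : (S ∩ S').card = 0
  · have hsep : ∀ e ∈ S', e ∉ S := fun e he' he =>
      Finset.notMem_empty e (Finset.card_eq_zero.1 h0 ▸ Finset.mem_inter.2 ⟨he, he'⟩)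
    have hEq : slotEvent H h D (x, w) ∩ slotEvent H h D (y, v) =
        {ω | ∀ e ∈ S ∪ S', ω e ∈ if e ∈ S then D w e else D v e} := by
      ext ω
      simp only [slotEvent, Set.mem_inter_iff, Set.mem_ofPred_eq, Finset.mem_union]
      refine ⟨fun hω e he => ?_, fun hω => ⟨fun e he => ?_, fun e he => ?_⟩⟩
      · by_cases heS : e ∈ S
        · rw [if_pos heS]
          exact hω.1 e heS
        · rw [if_neg heS]
          exact hω.2 e (he.resolve_left heS)
      · have := hω e (Or.inl he)
        rwa [if_pos he] at this
      · have := hω e (Or.inr he)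
        rwa [if_neg (hsep e he)] at this
    rw [hEq, labelMeasure_real_forall_mem ψ _ (q := c / W) fun e => by split_ifs <;> exact hq _ _,
      show (S ∪ S').card = 2 * K by omega]
    simp [h0]
  rw [if_neg h0]
  by_cases hwv : w = v
  · subst hwv
    have hEq : slotEvent H h D (x, w) ∩ slotEvent H h D (y, w) =
        {ω | ∀ e ∈ S ∪ S', ω e ∈ D w e} := by
      ext ω
      simp only [slotEvent, Set.mem_inter_iff, Set.mem_ofPred_eq, Finset.mem_union, or_imp,
        forall_and]
      rfl
    have hsi : (S ∩ S').card ≤ i := by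
      have h1 := hH.card_inter_le h rfl (agree_nonempty_of_card_inter_ne_zero h h0)
      have h2 := (Finset.univ.filter fun a => x a = y a).card_le_univ
      rw [Fintype.card_fin] at h2
      exact (Nat.le_add_right _ _).trans (h1.trans h2)
    rw [hEq, labelMeasure_real_forall_mem ψ _ (hq w), if_pos rfl, ← hcard, pow_add, mul_assoc]
    refine le_mul_of_one_le_right (by positivity) ?_
    set s := (S ∩ S').card
    calc (1 : ℝ) = (c / W) ^ s * ((c ^ s)⁻¹ * W ^ s) := by
          rw [div_pow]
          field_simp
      _ ≤ (c / W) ^ s * ((c ^ i)⁻¹ * W ^ s) := by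
          gcongr _ * (?_ * _)
          exact inv_anti₀ (by positivity) (pow_le_pow_of_le_one hc0.le hc1 hsi)
      _ ≤ _ := by
          push_cast
          gcongr
          linarith
  · obtain ⟨e, he⟩ := Finset.card_pos.1 (Nat.pos_of_ne_zero h0)
    have hEq : slotEvent H h D (x, w) ∩ slotEvent H h D (y, v) = ∅ :=
      Set.eq_empty_of_forall_notMem fun ω hω => Set.disjoint_left.1 (hdisj w v e hwv)
        (hω.1 e (Finset.mem_inter.1 he).1) (hω.2 e (Finset.mem_inter.1 he).2)
    rw [hEq, measureReal_empty, if_neg hwv]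
    positivity

/-- Chebyshev's bound, with mean `m ^ i * W * (c / W) ^ K`. The overlap sum from
`sum_pow_card_inter_le`, divided by `m ^ i * W`, is the right-hand side without the factor `(c ^
i)⁻¹`. -/
theorem labelMeasure_real_iInter_slotEvent_compl_le [NeZero i] (ψ : PMF ℕ)
    (hH : IsCycleSparse H) (h : i * m ≤ n) {c : ℝ} (hc0 : 0 < c) (hc1 : c ≤ 1) (hW : 0 < W)
    (hm : 0 < m) (hWm : W ^ (i - 1) ≤ m ^ i)
    (hD : ∀ w e, MeasurableSet (D w e)) (hq : ∀ w e, (edgeLaw ψ).real (D w e) = c / W)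
    (hdisj : ∀ w v e, w ≠ v → Disjoint (D w e) (D v e)) :
    (labelMeasure (Fin n) ψ).real (⋂ p, (slotEvent (m := m) H h D p)ᶜ) ≤
      (c ^ i)⁻¹ * (2 ^ i / m + (W : ℝ) ^ (i - 1) / m ^ i) := by
  have key := measureReal_iInter_compl_mul_sq_le (labelMeasure (Fin n) ψ)
    (A := slotEvent (m := m) H h D) fun p => measurableSet_forall_mem _ (hD p.2)
  have hW' : (0 : ℝ) < W := by exact_mod_cast hW
  have hm' : (0 : ℝ) < m := by exact_mod_cast hm
  set K := Fintype.card H.edgeSet with hK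
  have hM : ∑ p : (Fin i → Fin m) × Fin W, (labelMeasure (Fin n) ψ).real (slotEvent H h D p) =
      m ^ i * W * (c / W) ^ K := by
    simp [labelMeasure_real_slotEvent ψ h hq, hK]
  let g (x y : Fin i → Fin m) : ℕ := if (classEdges H h x ∩ classEdges H h y).card = 0 then 0
    else W ^ (classEdges H h x ∩ classEdges H h y).card
  have hg (x : Fin i → Fin m) : ∑ y, (g x y : ℝ) ≤
      W * (2 ^ i * (m : ℝ) ^ (i - 1) + (W : ℝ) ^ (i - 1)) := by
    exact_mod_cast sum_pow_card_inter_le hH h hm hW hWm x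
  have hsum : ∑ p : (Fin i → Fin m) × Fin W, ∑ p' : (Fin i → Fin m) × Fin W,
      (labelMeasure (Fin n) ψ).real (slotEvent H h D p ∩ slotEvent H h D p') ≤
      (c / W) ^ (2 * K) * ((m ^ i * W) ^ 2 + m ^ i * W * ((c ^ i)⁻¹ *
        (W * (2 ^ i * (m : ℝ) ^ (i - 1) + (W : ℝ) ^ (i - 1))))) := by
    calc _ ≤ ∑ p : (Fin i → Fin m) × Fin W, ∑ p' : (Fin i → Fin m) × Fin W,
          (c / W) ^ (2 * K) * (1 + if p.2 = p'.2 then (c ^ i)⁻¹ * (g p.1 p'.1 : ℝ) else 0) :=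
          Finset.sum_le_sum fun p _ => Finset.sum_le_sum fun p' _ =>
            labelMeasure_real_slotEvent_inter_le ψ hH h hc0 hc1 hW hq hdisj p p'
      _ ≤ ∑ p : (Fin i → Fin m) × Fin W, (c / W) ^ (2 * K) * (m ^ i * W + (c ^ i)⁻¹ *
            (W * (2 ^ i * (m : ℝ) ^ (i - 1) + (W : ℝ) ^ (i - 1)))) := by
          refine Finset.sum_le_sum fun p _ => ?_
          rw [← Finset.mul_sum, Finset.sum_add_distrib]
          refine mul_le_mul_of_nonneg_left (add_le_add ?_ ?_) (by positivity)
          · simp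
          · rw [Fintype.sum_prod_type]
            simp only [Finset.sum_ite_eq, Finset.mem_univ, if_true]
            rw [← Finset.mul_sum]
            gcongr
            exact hg p.1
      _ = _ := by
          rw [Finset.sum_const, nsmul_eq_mul]
          simp
          ring
  rw [hM] at key
  have hM0 : 0 < (m : ℝ) ^ i * W * (c / W) ^ K := by positivity
  rw [← le_div_iff₀ (by positivity)] at key
  refine key.trans ?_
  rw [div_le_iff₀ (by positivity)]
  calc _ ≤ (c / W) ^ (2 * K) * ((m ^ i * W) ^ 2 + m ^ i * W * ((c ^ i)⁻¹ *
        (W * (2 ^ i * (m : ℝ) ^ (i - 1) + (W : ℝ) ^ (i - 1))))) -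
        ((m : ℝ) ^ i * W * (c / W) ^ K) ^ 2 := by linarith
    _ = _ := by
      obtain ⟨j, hj⟩ : ∃ j, i = j + 1 := Nat.exists_eq_succ_of_ne_zero (NeZero.ne i)
      rw [hj, Nat.add_sub_cancel, pow_succ (m : ℝ) j]
      have : (c ^ (j + 1))⁻¹ ≠ 0 := by positivity
      generalize (c ^ (j + 1))⁻¹ = C at *
      generalize (c / W) = q at *
      field_simp
      ring

end

/-! ### Sparsity of cycles -/

open Fin.NatCast in
theorem exists_mem_add_one_notMem {k : ℕ} {T : Finset (Fin (k + 1))} (hne : T.Nonempty)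
    (hT : T ≠ Finset.univ) : ∃ a ∈ T, a + 1 ∉ T := by
  by_contra! hclosed
  obtain ⟨a, ha⟩ := hne
  have hall (j : ℕ) : a + (j : Fin (k + 1)) ∈ T := by
    induction j with
    | zero => simpa using ha
    | succ j ih =>
      rw [Nat.cast_succ, ← add_assoc]
      exact hclosed _ ih
  refine hT (Finset.eq_univ_iff_forall.2 fun b => ?_)
  have := hall (b - a).val
  rwa [Fin.cast_val_eq_self, add_sub_cancel] at this

/-- Every edge inside `T` is `s(a, a + 1)` with `a` and `a + 1` in `T`, so there are at most
`T.card` of them; a proper nonempty `T` is not closed under successor, which loses one. -/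
theorem isCycleSparse_cycleGraph {i : ℕ} (hi : 3 ≤ i) :
    IsCycleSparse (SimpleGraph.cycleGraph i) := by
  obtain ⟨k, rfl⟩ := Nat.exists_eq_add_of_le' hi
  intro T hne
  have hle : (Finset.univ.filter fun e : (SimpleGraph.cycleGraph (k + 3)).edgeSet =>
      ∀ a ∈ e.1, a ∈ T).card ≤ (T.filter fun a => a + 1 ∈ T).card := by
    rw [← Finset.card_map (Function.Embedding.subtype _)]
    refine (Finset.card_le_card fun e he => ?_).trans
      (Finset.card_image_le (f := fun a : Fin (k + 3) => s(a, a + 1)))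
    obtain ⟨⟨e, hadj⟩, hmem, rfl⟩ := Finset.mem_map.1 he
    replace he := (Finset.mem_filter.1 hmem).2
    induction e with | _ a b =>
    have ha : a ∈ T := he a (Sym2.mem_mk_left a b)
    have hb : b ∈ T := he b (Sym2.mem_mk_right a b)
    refine Finset.mem_image.2 ?_
    rcases SimpleGraph.cycleGraph_adj.1 hadj with h | h
    · obtain rfl : a = b + 1 := by rw [← h]; abel
      exact ⟨b, Finset.mem_filter.2 ⟨hb, ha⟩, Sym2.eq_swap⟩
    · obtain rfl : b = a + 1 := by rw [← h]; abel
      exact ⟨a, Finset.mem_filter.2 ⟨ha, hb⟩, rfl⟩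
  split_ifs with hT
  · exact hle.trans (Finset.card_filter_le _ _)
  · obtain ⟨a, ha, ha1⟩ := exists_mem_add_one_notMem hne hT
    exact Nat.succ_le_of_lt (hle.trans_lt (Finset.card_lt_card
      (Finset.filter_ssubset.2 ⟨a, ha, ha1⟩)))

/-! ### Ranks and slots -/

/-- A strict partial order on a finite type has a strictly monotone rank function. -/
theorem exists_rank {α : Type*} [Fintype α] (P : α → α → Prop) [IsStrictOrder α P] :
    ∃ r : α → ℕ, (∀ e, r e < Fintype.card α) ∧ ∀ e f, P e f → r e < r f := by
  classical
  -- The rank of `e` is its number of predecessors.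
  refine ⟨fun e => (Finset.univ.filter fun f => P f e).card, fun e => ?_, fun e f hef => ?_⟩
  · refine Finset.card_lt_univ_of_notMem (x := e) fun he => ?_
    exact irrefl e (Finset.mem_filter.1 he).2
  · refine Finset.card_lt_card ⟨fun g hg => ?_, fun hsub => ?_⟩
    · rw [Finset.mem_filter_univ] at hg ⊢
      exact _root_.trans hg hef
    · exact irrefl e (Finset.mem_filter.1 (hsub (Finset.mem_filter.2 ⟨Finset.mem_univ e, hef⟩))).2

/-- Slot `s` of `(0, 1]`, cut into `M` slots of the same length. -/
def slot (M s : ℕ) : Set (ℕ × (ℕ → Set.Ioc (0 : ℝ) 1)) :=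
  firstLabelIn (s / M) ((s + 1) / M)

theorem edgeLaw_real_slot (ψ : PMF ℕ) {M s : ℕ} (hs : s < M) :
    (edgeLaw ψ).real (slot M s) = ψ.toMeasure.real (Set.Ioi 0) / M := by
  have hM : (0 : ℝ) < M := by exact_mod_cast (Nat.zero_le s).trans_lt hs
  rw [measureReal_def, slot, edgeLaw_firstLabelIn ψ (by positivity), ENNReal.toReal_mul,
    ENNReal.toReal_ofReal, ← measureReal_def]
  · ring
  · rw [sub_nonneg]
    gcongr
    linarith
  · rw [div_le_one hM]
    exact_mod_cast hs

/-- True because slots look at the first label only: an edge with several labels could otherwise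
meet several slots. -/
theorem disjoint_slot {M s s' : ℕ} (hM : 0 < M) (h : s ≠ s') : Disjoint (slot M s) (slot M s') := by
  have hM' : (0 : ℝ) < M := by exact_mod_cast hM
  refine Set.disjoint_left.2 fun p hp hp' => h ?_
  have h1 := hp.2.1.trans_le hp'.2.2
  have h2 := hp'.2.1.trans_le hp.2.2
  rw [div_lt_div_iff_of_pos_right hM'] at h1 h2
  have h3 : s < s' + 1 := by exact_mod_cast h1
  have h4 : s' < s + 1 := by exact_mod_cast h2
  omega

open Classical in
/-- The rank of an edge between vertex classes, given a rank function on the edges of `H`. -/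
noncomputable def classRank {i n : ℕ} [NeZero i] (H : SimpleGraph (Fin i)) (r : H.edgeSet → ℕ)
    (e : (⊤ : SimpleGraph (Fin n)).edgeSet) : ℕ :=
  -- The default 0 concerns only edges that lie in no counted copy; it keeps the slot index in
  -- range, so that every edge has the same slot probability.
  if h : Sym2.map (vertexClass i) (e : Sym2 (Fin n)) ∈ H.edgeSet then r ⟨_, h⟩ else 0

theorem classRank_mapEdgeSet {i m n : ℕ} [NeZero i] (H : SimpleGraph (Fin i)) (r : H.edgeSet → ℕ)
    (h : i * m ≤ n) (x : Fin i → Fin m) (e : H.edgeSet) :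
    classRank H r ((classCopy H h x).mapEdgeSet e) = r e := by
  simp only [classRank, map_vertexClass_mapEdgeSet, Subtype.coe_prop, dite_true]

theorem classRank_lt {i n N : ℕ} [NeZero i] (H : SimpleGraph (Fin i)) {r : H.edgeSet → ℕ}
    (hN : 0 < N) (hr : ∀ e, r e < N) (e : (⊤ : SimpleGraph (Fin n)).edgeSet) :
    classRank H r e < N := by
  unfold classRank
  split_ifs
  exacts [hr _, hN]

theorem add_lt_mul_of_lt {W N w s : ℕ} (hw : w < W) (hs : s < N) : w * N + s < W * N := by
  have := Nat.mul_le_mul_right N (Nat.succ_le_of_lt hw)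
  rw [Nat.succ_mul] at this
  omega

/-- Slots are half-open, so a larger rank forces a strictly larger label. All slots of window `w`
lie in `(w / W, (w + 1) / W]`, whose length is at most `δ`, and half-openness makes the differences
strictly less than `δ`. -/
theorem containsMotif_of_mem_slotEvent {i m n W N : ℕ} [NeZero i] {H : SimpleGraph (Fin i)}
    [Fintype H.edgeSet] {P : H.edgeSet → H.edgeSet → Prop} {r : H.edgeSet → ℕ}
    (hr : ∀ e, r e < N) (hrP : ∀ e f, P e f → r e < r f) (h : i * m ≤ n) (hN : 0 < N)
    {δ : ℝ} (hδ : 0 < δ) (hW : 1 / δ ≤ W) {ω : LabelSample (Fin n)}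
    {p : (Fin i → Fin m) × Fin W}
    (hω : ω ∈ slotEvent H h (fun w e => slot (W * N) (w * N + classRank H r e)) p) :
    (randomTemporalGraph ω).ContainsMotif H P δ := by
  obtain ⟨x, w⟩ := p
  rw [containsMotif_randomTemporalGraph_iff]
  have hW0 : (0 : ℝ) < W := lt_of_lt_of_le (by positivity) hW
  have hN0 : (0 : ℝ) < N := by exact_mod_cast hN
  have hslot (e : H.edgeSet) :
      ω ((classCopy H h x).mapEdgeSet e) ∈ slot (W * N) (w * N + r e) := by
    have := hω _ (Finset.mem_map_of_mem _ (Finset.mem_univ e))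
    beta_reduce at this
    rwa [classRank_mapEdgeSet] at this
  refine ⟨classCopy H h x, fun _ => 0, fun e => (hslot e).1, fun e f hef => ?_, fun e f => ?_⟩
  · refine (hslot e).2.2.trans_lt (lt_of_le_of_lt ?_ (hslot f).2.1)
    gcongr
    have : r e + 1 ≤ r f := hrP e f hef
    exact_mod_cast (show (w : ℕ) * N + r e + 1 ≤ w * N + r f by omega)
  · have h1 := (hslot e).2.2
    have h2 := (hslot f).2.1
    have h3 : (((w * N + r e : ℕ) : ℝ) + 1) / (W * N : ℕ) ≤ (w + 1) / W := by
      push_cast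
      rw [← mul_div_mul_right ((w : ℝ) + 1) (W : ℝ) hN0.ne']
      gcongr
      have : (r e : ℝ) + 1 ≤ N := by exact_mod_cast hr e
      linarith
    have h4 : (w : ℝ) / W ≤ ((w * N + r f : ℕ) : ℝ) / (W * N : ℕ) := by
      push_cast
      rw [← mul_div_mul_right (w : ℝ) (W : ℝ) hN0.ne']
      gcongr
      have : (0 : ℝ) ≤ r f := Nat.cast_nonneg _
      linarith
    have h5 : 1 / (W : ℝ) ≤ δ := by
      rw [div_le_iff₀ hW0]
      rwa [div_le_iff₀ hδ, mul_comm] at hW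
    have h6 : ((w : ℝ) + 1) / W = w / W + 1 / W := add_div _ _ _
    linarith

/-! ### Existence above the threshold -/

theorem labelMeasure_real_not_containsMotif_le {ψ : PMF ℕ} (hψ : IsLabelMultiplicity ψ)
    {i m n W : ℕ} (hi : 3 ≤ i)
    (P : (SimpleGraph.cycleGraph i).edgeSet → (SimpleGraph.cycleGraph i).edgeSet → Prop)
    [IsStrictOrder _ P] (h : i * m ≤ n) (hm : 0 < m) (hWm : W ^ (i - 1) ≤ m ^ i) {δ : ℝ}
    (hδ : 0 < δ) (hW : 1 / δ ≤ W) :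
    labelMeasure (Fin n) ψ
      {ω | ¬ (randomTemporalGraph ω).ContainsMotif (SimpleGraph.cycleGraph i) P δ} ≤
      ENNReal.ofReal (((ψ.toMeasure.real (Set.Ioi 0) / i) ^ i)⁻¹ *
        (2 ^ i / m + (W : ℝ) ^ (i - 1) / m ^ i)) := by
  have : NeZero i := ⟨by omega⟩
  have hi0 : 0 < i := by omega
  have hi0' : (0 : ℝ) < i := by exact_mod_cast hi0
  have hi1' : (1 : ℝ) ≤ i := by exact_mod_cast hi0
  obtain ⟨r, hr, hrP⟩ := exists_rank P
  rw [card_edgeSet_cycleGraph hi] at hr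
  have hW0 : 0 < W := by
    have : (0 : ℝ) < W := lt_of_lt_of_le (by positivity) hW
    exact_mod_cast this
  have hp0 : 0 < ψ.toMeasure.real (Set.Ioi 0) :=
    ENNReal.toReal_pos hψ.toMeasure_Ioi_pos.ne' (measure_ne_top _ _)
  let D (w : Fin W) (e : (⊤ : SimpleGraph (Fin n)).edgeSet) :=
    slot (W * i) (w * i + classRank (SimpleGraph.cycleGraph i) r e)
  have hlt (w : Fin W) (e : (⊤ : SimpleGraph (Fin n)).edgeSet) :
      w * i + classRank (SimpleGraph.cycleGraph i) r e < W * i :=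
    add_lt_mul_of_lt w.2 (classRank_lt _ hi0 hr e)
  -- A slot has length `1 / (W * i)` and the edge must have a label at all, whence `c =
  -- ψ.toMeasure.real (Set.Ioi 0) / i`.
  have key := labelMeasure_real_iInter_slotEvent_compl_le (D := D) ψ
    (isCycleSparse_cycleGraph hi) h (c := ψ.toMeasure.real (Set.Ioi 0) / i) (by positivity)
    ((div_le_one hi0').2 (measureReal_le_one.trans hi1')) hW0 hm hWm
    (fun w e => measurableSet_firstLabelIn _ _)
    (fun w e => by
      rw [edgeLaw_real_slot ψ (hlt w e), Nat.cast_mul, div_div, mul_comm])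
    (fun w v e hwv => disjoint_slot (by positivity) fun hEq => hwv (Fin.ext
      (Nat.eq_of_mul_eq_mul_right hi0 (Nat.add_right_cancel hEq))))
  refine (measure_mono fun ω hω => ?_).trans
    ((ENNReal.le_ofReal_iff_toReal_le (measure_ne_top _ _) (by positivity)).2 key)
  exact Set.mem_iInter.2 fun p hp =>
    hω (containsMotif_of_mem_slotEvent hr hrP h hi0 hδ hW hp)

theorem div_two_mul_le_natCast_div {i n : ℕ} (hi : 0 < i) (hn : 2 * i ≤ n) :
    (n : ℝ) / (2 * i) ≤ (n / i : ℕ) := by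
  have h1 : n < i * (n / i + 1) := Nat.lt_mul_div_succ n hi
  have hi' : (0 : ℝ) < i := by exact_mod_cast hi
  rw [div_le_iff₀ (by positivity)]
  have h2 : 1 ≤ n / i := by rw [Nat.le_div_iff_mul_le hi]; omega
  have h3 : n ≤ n / i * (2 * i) := by nlinarith
  exact_mod_cast h3

theorem tendsto_labelMeasure_not_containsMotif {ψ : PMF ℕ} (hψ : IsLabelMultiplicity ψ) {i : ℕ}
    (hi : 3 ≤ i)
    (P : (SimpleGraph.cycleGraph i).edgeSet → (SimpleGraph.cycleGraph i).edgeSet → Prop)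
    [IsStrictOrder _ P] {δ : ℕ → ℝ} (hδ : IsLittleOmega δ (cycleThreshold i)) :
    Tendsto (fun n : ℕ => labelMeasure (Fin n) ψ
      {ω | ¬ (randomTemporalGraph ω).ContainsMotif (SimpleGraph.cycleGraph i) P (δ n)})
      atTop (𝓝 0) := by
  have hi0 : 0 < i := by omega
  have hi0' : (0 : ℝ) < i := by exact_mod_cast hi0
  have hratio : Tendsto (fun n => cycleThreshold i n / δ n) atTop (𝓝 0) :=
    hδ.2.tendsto_div_nhds_zero
  have hδpos : ∀ᶠ n in atTop, 0 < δ n := by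
    filter_upwards [hδ.1, hδ.2.bound one_pos, eventually_gt_atTop 0] with n h0 h1 hn
    have hτ := cycleThreshold_pos i hn
    rw [Real.norm_of_nonneg hτ.le, Real.norm_of_nonneg h0] at h1
    linarith
  let u : ℕ → ℝ := fun n => (2 * i) ^ i * 2 ^ (i - 1) *
    ((cycleThreshold i n / δ n) ^ (i - 1) + ((n : ℝ) ^ i)⁻¹)
  have hu : Tendsto u atTop (𝓝 0) := by
    have h1 : Tendsto (fun n : ℕ => ((n : ℝ) ^ i)⁻¹) atTop (𝓝 0) :=
      ((tendsto_pow_atTop hi0.ne').comp tendsto_natCast_atTop_atTop).inv_tendsto_atTop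
    simpa [show i - 1 ≠ 0 by omega] using
      ((hratio.pow (i - 1)).add h1).const_mul ((2 * (i : ℝ)) ^ i * 2 ^ (i - 1))
  have hbound : ∀ᶠ n in atTop,
      (⌈1 / δ n⌉₊ : ℝ) ^ (i - 1) / ((n / i : ℕ) : ℝ) ^ i ≤ u n := by
    filter_upwards [hδpos, eventually_ge_atTop (2 * i), eventually_gt_atTop 0] with n h0 hn hn0
    have hn0' : (0 : ℝ) < n := by exact_mod_cast hn0
    -- `δ n` may exceed 1, where the ceiling stays at 1; the summand `+ 1` covers this and becomes
    -- the term `(n ^ i)⁻¹` of `u`.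
    have hceil : (⌈1 / δ n⌉₊ : ℝ) ^ (i - 1) ≤ 2 ^ (i - 1) * ((1 / δ n) ^ (i - 1) + 1) := by
      have hc := (Nat.ceil_lt_add_one (by positivity : 0 ≤ 1 / δ n)).le
      have hpos : 0 < 1 / δ n := by positivity
      rcases le_total (1 / δ n) 1 with h | h
      · calc (⌈1 / δ n⌉₊ : ℝ) ^ (i - 1) ≤ 2 ^ (i - 1) := by gcongr; linarith
          _ ≤ _ := le_mul_of_one_le_right (by positivity) (by linarith [pow_pos hpos (i - 1)])
      · calc (⌈1 / δ n⌉₊ : ℝ) ^ (i - 1) ≤ (2 * (1 / δ n)) ^ (i - 1) := by gcongr; linarith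
          _ = 2 ^ (i - 1) * (1 / δ n) ^ (i - 1) := mul_pow _ _ _
          _ ≤ _ := by gcongr; linarith
    calc _ ≤ 2 ^ (i - 1) * ((1 / δ n) ^ (i - 1) + 1) / ((n : ℝ) / (2 * i)) ^ i := by
          gcongr
          exact div_two_mul_le_natCast_div hi0 hn
      _ = u n := by
          simp only [u]
          rw [div_pow (cycleThreshold i n), cycleThreshold_pow (by omega), div_pow, div_pow, one_pow]
          field_simp
  have hm : Tendsto (fun n : ℕ => n / i) atTop atTop := Nat.tendsto_div_const_atTop hi0.ne'
  set C := ((ψ.toMeasure.real (Set.Ioi 0) / i) ^ i)⁻¹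
  have hlim : Tendsto (fun n => ENNReal.ofReal (C * (2 ^ i / (n / i : ℕ) + u n))) atTop (𝓝 0) := by
    rw [← ENNReal.ofReal_zero]
    refine ENNReal.tendsto_ofReal ?_
    have h1 : Tendsto (fun n : ℕ => (2 : ℝ) ^ i / (n / i : ℕ)) atTop (𝓝 0) :=
      (tendsto_natCast_atTop_atTop.comp hm).const_div_atTop _
    simpa using (h1.add hu).const_mul C
  refine tendsto_of_tendsto_of_tendsto_of_le_of_le' tendsto_const_nhds hlim
    (Eventually.of_forall fun n => zero_le) ?_
  -- Eventually `u n < 1`, which supplies the hypothesis `W ^ (i - 1) ≤ m ^ i` of the overlap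
  -- estimate.
  filter_upwards [hδpos, hbound, hm.eventually_gt_atTop 0, hu.eventually_lt_const one_pos]
    with n h0 hb hm0 hu1
  have hm0' : (0 : ℝ) < (n / i : ℕ) := by exact_mod_cast hm0
  refine (labelMeasure_real_not_containsMotif_le hψ hi P (Nat.mul_div_le n i) hm0 ?_ h0
    (Nat.le_ceil _)).trans (ENNReal.ofReal_le_ofReal ?_)
  · have := hb.trans hu1.le
    rw [div_le_one (by positivity)] at this
    exact_mod_cast this
  · gcongr

/-- Subadditivity alone gives this, so no measurability of the motif event is needed. -/
theorem tendsto_measure_one_of_tendsto_not {Ω : ℕ → Type*} [∀ n, MeasurableSpace (Ω n)]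
    (μ : ∀ n, Measure (Ω n)) [∀ n, IsProbabilityMeasure (μ n)] {p : ∀ n, Ω n → Prop}
    (h : Tendsto (fun n => μ n {ω | ¬ p n ω}) atTop (𝓝 0)) :
    Tendsto (fun n => μ n {ω | p n ω}) atTop (𝓝 1) := by
  have hlim : Tendsto (fun n => 1 - μ n {ω | ¬ p n ω}) atTop (𝓝 1) := by
    simpa using ENNReal.Tendsto.sub tendsto_const_nhds h (Or.inl ENNReal.one_ne_top)
  refine tendsto_of_tendsto_of_tendsto_of_le_of_le hlim tendsto_const_nhds (fun n => ?_)
    fun n => prob_le_one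
  rw [tsub_le_iff_right]
  calc (1 : ENNReal) = μ n ({ω | p n ω} ∪ {ω | ¬ p n ω}) := by
        rw [← measure_univ (μ := μ n)]
        congr 1
        ext ω
        simp [em]
    _ ≤ _ := measure_union_le _ _

theorem containsMotifWhp_cycleGraph {ψ : PMF ℕ} (hψ : IsLabelMultiplicity ψ) {i : ℕ}
    (hi : 3 ≤ i)
    (P : (SimpleGraph.cycleGraph i).edgeSet → (SimpleGraph.cycleGraph i).edgeSet → Prop)
    [IsStrictOrder _ P] {δ : ℕ → ℝ} (hδ : IsLittleOmega δ (cycleThreshold i)) :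
    ContainsMotifWhp ψ (SimpleGraph.cycleGraph i) P δ :=
  tendsto_measure_one_of_tendsto_not _ (tendsto_labelMeasure_not_containsMotif hψ hi P hδ)

theorem avoidsMotifWhp_cycleGraph {ψ : PMF ℕ} (hψ : IsLabelMultiplicity ψ) {i : ℕ}
    (hi : 3 ≤ i)
    (P : (SimpleGraph.cycleGraph i).edgeSet → (SimpleGraph.cycleGraph i).edgeSet → Prop)
    {δ : ℕ → ℝ} (hδ : δ =o[atTop] cycleThreshold i) :
    AvoidsMotifWhp ψ (SimpleGraph.cycleGraph i) P δ := by
  refine tendsto_measure_one_of_tendsto_not _ ?_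
  simpa only [not_not] using tendsto_labelMeasure_containsMotif hψ hi P hδ

/-! ### Thresholds of different cycles are distinct -/

theorem cycleThreshold_isLittleO {i j : ℕ} (hi : 3 ≤ i) (hij : i < j) :
    cycleThreshold i =o[atTop] cycleThreshold j := by
  have hi' : (3 : ℝ) ≤ i := by exact_mod_cast hi
  have hij' : (i : ℝ) < j := by exact_mod_cast hij
  have hexp : 0 < (i : ℝ) / (i - 1) - j / (j - 1) := by
    rw [div_sub_div _ _ (by linarith) (by linarith)]
    exact div_pos (by linarith) (mul_pos (by linarith) (by linarith))
  refine (isLittleO_iff_tendsto' ?_).2 ?_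
  · filter_upwards [eventually_gt_atTop 0] with n hn h
    exact absurd h (cycleThreshold_pos j hn).ne'
  · refine Tendsto.congr' ?_
      ((tendsto_rpow_neg_atTop hexp).comp tendsto_natCast_atTop_atTop)
    filter_upwards [eventually_gt_atTop 0] with n hn
    rw [cycleThreshold, cycleThreshold, ← Real.rpow_sub (by exact_mod_cast hn)]
    simp only [Function.comp_apply]
    congr 1
    ring

theorem not_isMotifThreshold_both {ψ : PMF ℕ} (hψ : IsLabelMultiplicity ψ) {i j : ℕ}
    (hi : 3 ≤ i) (hij : i < j)
    (P : (SimpleGraph.cycleGraph i).edgeSet → (SimpleGraph.cycleGraph i).edgeSet → Prop)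
    (Q : (SimpleGraph.cycleGraph j).edgeSet → (SimpleGraph.cycleGraph j).edgeSet → Prop)
    [IsStrictOrder _ P] {τ : ℕ → ℝ} (hP : IsMotifThreshold ψ (SimpleGraph.cycleGraph i) P τ)
    (hQ : IsMotifThreshold ψ (SimpleGraph.cycleGraph j) Q τ) : False := by
  set a := cycleThreshold i
  set b := cycleThreshold j
  have ha : ∀ᶠ n in atTop, 0 < a n := by
    filter_upwards [eventually_gt_atTop 0] with n hn using cycleThreshold_pos i hn
  have hb : ∀ᶠ n in atTop, 0 < b n := by
    filter_upwards [eventually_gt_atTop 0] with n hn using cycleThreshold_pos j hn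
  -- `s` is the fourth root of `a / b`, so that `b * s ^ 2` lies half way between `a` and `b`
  let s : ℕ → ℝ := fun n => √√(a n / b n)
  have hs0 : ∀ n, 0 ≤ s n := fun n => Real.sqrt_nonneg _
  have hs : Tendsto s atTop (𝓝 0) := by
    have := (cycleThreshold_isLittleO hi hij).tendsto_div_nhds_zero.sqrt.sqrt
    simpa using this
  have hs4 : ∀ᶠ n in atTop, 0 < s n ∧ a n = b n * s n ^ 4 := by
    filter_upwards [ha, hb] with n han hbn
    have hd : 0 < a n / b n := div_pos han hbn
    refine ⟨Real.sqrt_pos.2 (Real.sqrt_pos.2 hd), ?_⟩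
    rw [show s n ^ 4 = (s n ^ 2) ^ 2 by ring, Real.sq_sqrt (Real.sqrt_nonneg _), Real.sq_sqrt hd.le]
    field_simp
  have isLittleO_of {f g : ℕ → ℝ} (h : ∀ᶠ n in atTop, 0 ≤ f n ∧ f n ≤ s n * g n) :
      f =o[atTop] g := by
    refine IsBigO.trans_isLittleO (g := fun n => s n * g n) ?_ ?_
    · refine IsBigO.of_bound 1 ?_
      filter_upwards [h] with n hn
      rw [one_mul, Real.norm_of_nonneg hn.1]
      exact hn.2.trans (le_abs_self _)
    · simpa using ((isLittleO_one_iff ℝ).2 hs).mul_isBigO (isBigO_refl g atTop)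
  -- If `τ` is eventually below the midpoint, `b * s` is `ω(τ)` but `o(b)`: the longer cycle would
  -- be both contained and avoided.
  by_cases hτ : ∀ᶠ n in atTop, τ n < b n * s n ^ 2
  · have hω : IsLittleOmega (fun n => b n * s n) τ := by
      refine ⟨?_, isLittleO_of ?_⟩
      · filter_upwards [hb] with n hbn using mul_nonneg hbn.le (hs0 n)
      · filter_upwards [hτ, hP.1] with n h1 h2
        exact ⟨h2.le, h1.le.trans_eq (by ring)⟩
    have h0 := tendsto_labelMeasure_containsMotif hψ (hi.trans hij.le) Q
      (δ := fun n => b n * s n) (isLittleO_of (by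
        filter_upwards [hb] with n hbn
        exact ⟨mul_nonneg hbn.le (hs0 n), (mul_comm _ _).le⟩))
    exact zero_ne_one (tendsto_nhds_unique h0 (hQ.2.1 _ hω))
  · have hω : IsLittleOmega (fun n => b n * s n ^ 3) a := by
      refine ⟨?_, isLittleO_of ?_⟩
      · filter_upwards [hb] with n hbn using mul_nonneg hbn.le (pow_nonneg (hs0 n) 3)
      · filter_upwards [ha, hs4] with n han hn
        exact ⟨han.le, by rw [hn.2]; exact le_of_eq (by ring)⟩
    -- Otherwise `τ ≥ b * s ^ 2` for infinitely many `n`, and the shorter cycle gives the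
    -- contradiction: `b * s ^ 3` is `ω(a)`. The minimum makes the second test window `o(τ)` along
    -- all `n`, while it equals `b * s ^ 3` at those infinitely many `n`; there the probability of
    -- avoidance is both below and above `2⁻¹`.
    have h0 := tendsto_labelMeasure_not_containsMotif hψ hi P hω
    have h1 := hP.2.2 (fun n => s n * min (b n * s n ^ 2) (τ n)) (isLittleO_of (by
      filter_upwards [hb, hP.1] with n hbn hτn
      have := hs0 n
      exact ⟨mul_nonneg this (le_min (by positivity) hτn.le), by gcongr; exact min_le_right _ _⟩))
    obtain ⟨n, hn, hn0, hn1⟩ := ((not_eventually.1 hτ).and_eventually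
      ((h0.eventually_lt_const (u := 2⁻¹) (by simp)).and
        (h1.eventually_const_lt (u := 2⁻¹) (by simp)))).exists
    simp only [min_eq_left (not_lt.1 hn)] at hn1
    rw [show s n * (b n * s n ^ 2) = b n * s n ^ 3 by ring] at hn1
    exact lt_asymm hn0 hn1

theorem mainTheorem3 (ψ : PMF ℕ) (hψ : IsLabelMultiplicity ψ) :
    (∀ i : ℕ, 3 ≤ i →
      ∀ P : (SimpleGraph.cycleGraph i).edgeSet → (SimpleGraph.cycleGraph i).edgeSet → Prop,
      IsStrictOrder _ P → ∀ δ : ℕ → ℝ,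
        (IsLittleOmega δ (cycleThreshold i) →
          ContainsMotifWhp ψ (SimpleGraph.cycleGraph i) P δ) ∧
        (δ =o[atTop] cycleThreshold i →
          AvoidsMotifWhp ψ (SimpleGraph.cycleGraph i) P δ)) ∧
    (∀ i j : ℕ, 3 ≤ i → i < j →
      cycleThreshold i =o[atTop] cycleThreshold j ∧
      ∀ (P : (SimpleGraph.cycleGraph i).edgeSet → (SimpleGraph.cycleGraph i).edgeSet → Prop)
        (Q : (SimpleGraph.cycleGraph j).edgeSet → (SimpleGraph.cycleGraph j).edgeSet → Prop),
      IsStrictOrder _ P → IsStrictOrder _ Q →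
        ¬ ∃ τ : ℕ → ℝ, IsMotifThreshold ψ (SimpleGraph.cycleGraph i) P τ ∧
          IsMotifThreshold ψ (SimpleGraph.cycleGraph j) Q τ) := by
  refine ⟨fun i hi P _ δ => ⟨containsMotifWhp_cycleGraph hψ hi P,
    avoidsMotifWhp_cycleGraph hψ hi P⟩, fun i j hi hij =>
    ⟨cycleThreshold_isLittleO hi hij, fun P Q _ _ => ?_⟩⟩
  rintro ⟨τ, hP, hQ⟩
  exact not_isMotifThreshold_both hψ hi hij P Q hP hQ
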